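/- Let $\beta>1$ be a real number and let $f_\beta(x)=\beta x \pmod 1$. For $x\in[0,1)$ let $d(x,\beta)=(d(x,\beta)_n)_{n\ge 0}$ with $d(x,\beta)_n=\lfloor \beta f_\beta^n(x)\rfloor$ (integer part), and let the $\beta$-shift $S_\beta$ be the closure of $\{d(x,\beta):x\in[0,1)\}$ in the product topology. Put $\pi_\beta\big((i_k)_{k\ge0}\big)=\sum_{k\ge0} i_k\beta^{-(k+1)}$ for $(i_k)_{k\ge 0}\in S_\beta$. Let $\Sigma_A\subset S_\beta$ be a (one-sided) subshift of finite type, that is, the set of all sequences over a finite alphabet $\{0,\dots,m-1\}$ in which no word from some finite set of words occurs. Suppose that some finite word occurs in a sequence of $S_\beta$ but in no sequence of $\Sigma_A$. Then there exists $\alpha\in(0,1)$ such that the set $$G_{f_\beta}(\pi_\beta(\Sigma_A))=\Big\{\,y\in[0,1):\ \pi_\beta(\Sigma_A)\cap\overline{\{f_\beta^n(y):n\ge1\}}=\emptyset\,\Big\}$$ is $\alpha$-winning in the following sense. Given $E\subset[0,1]$ and $\alpha,\gamma\in(0,1)$, Black first chooses a closed interval $B_0\subset[0,1]$; then, for $k=0,1,2,\dots$,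 White chooses a closed interval $W_k\subset B_k$ with $|W_k|\ge\alpha|B_k|$, and Black chooses a closed interval $B_{k+1}\subset W_k$ with $|B_{k+1}|\ge\gamma|W_k|$ (all intervals have positive length). The set $E$ is $(\alpha,\gamma)$-winning if White has a strategy that guarantees $\bigcap_k W_k\subset E$, and $\alpha$-winning if it is $(\alpha,\gamma)$-winning for every $\gamma\in(0,1)$. -/

import Mathlib

open Set

noncomputable section

/-- The beta-transformation `x ↦ β x mod 1`. -/
def betaMap (β : ℝ) (x : ℝ) : ℝ := Int.fract (β * x)

/-- The digit sequence `d(x, β)`: the `n`-th digit is the integer part of `β * f_β^n (x)`. -/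
def betaDigits (β : ℝ) (x : ℝ) (n : ℕ) : ℕ := ⌊β * (betaMap β)^[n] x⌋₊

/-- The beta-shift `S_β`: the closure, in the product topology of `ℕ → ℕ` (discrete factors),
of the digit sequences of the points of `[0, 1)`. -/
def betaShift (β : ℝ) : Set (ℕ → ℕ) := closure (betaDigits β '' Ico (0 : ℝ) 1)

/-- The map `π_β`, sending `(i_k)` to `∑ i_k / β ^ (k + 1)`. -/
def betaProj (β : ℝ) (s : ℕ → ℕ) : ℝ := ∑' k : ℕ, (s k : ℝ) / β ^ (k + 1)

/-- The finite word `w` occurs in the sequence `s` at position `n`. -/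
def OccursAt (w : List ℕ) (s : ℕ → ℕ) (n : ℕ) : Prop :=
  ∀ i : Fin w.length, s (n + i) = w.get i

/-- The set of finite words that occur in some sequence of `X`. -/
def language (X : Set (ℕ → ℕ)) : Set (List ℕ) :=
  {w | ∃ s ∈ X, ∃ n, OccursAt w s n}

/-- A (one-sided) subshift of finite type: all sequences over a finite alphabet
`{0, …, m - 1}` in which no word of a given finite set of words occurs. -/
def IsSubshiftOfFiniteType (X : Set (ℕ → ℕ)) : Prop :=
  ∃ (m : ℕ) (F : Finset (List ℕ)),
    X = {s | (∀ k, s k < m) ∧ ∀ w ∈ F, ∀ n, ¬ OccursAt w s n}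

/-- The points `y` of `[0, 1)` such that the closure of `{f_β^n (y) : n ≥ 1}` does not
meet `K`. -/
def avoidingSet (β : ℝ) (K : Set ℝ) : Set ℝ :=
  {y | y ∈ Ico (0 : ℝ) 1 ∧ K ∩ closure {z | ∃ n : ℕ, 1 ≤ n ∧ z = (betaMap β)^[n] y} = ∅}

/-- A closed subinterval of `[0, 1]` of positive length: a move of the game. -/
structure GameInterval where
  left : ℝ
  right : ℝ
  zero_le_left : 0 ≤ left
  left_lt_right : left < right
  right_le_one : right ≤ 1

/-- The set of points of the interval. -/
def GameInterval.toSet (I : GameInterval) : Set ℝ := Icc I.left I.right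

/-- The length of the interval. -/
def GameInterval.length (I : GameInterval) : ℝ := I.right - I.left

/-- A strategy for White answers the moves `B_0, …, B_k` made by Black so far
by an interval `W_k`. -/
abbrev WhiteStrategy : Type := (k : ℕ) → (Fin (k + 1) → GameInterval) → GameInterval

/-- All answers of the strategy obey White's rule: `W_k ⊆ B_k` and `|W_k| ≥ α |B_k|`. -/
def WhiteStrategy.Legal (α : ℝ) (σ : WhiteStrategy) : Prop :=
  ∀ (k : ℕ) (B : Fin (k + 1) → GameInterval),
    (σ k B).toSet ⊆ (B (Fin.last k)).toSet ∧ α * (B (Fin.last k)).length ≤ (σ k B).length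

/-- White's move `W_k` when Black plays `B_0, B_1, …` and White follows `σ`. -/
def WhiteStrategy.answer (σ : WhiteStrategy) (B : ℕ → GameInterval) (k : ℕ) : GameInterval :=
  σ k (fun i => B i)

/-- `E` is `(α, γ)`-winning for the modified Schmidt game on `[0, 1]`: White has a strategy
such that, whenever Black obeys the rule `B_{k+1} ⊆ W_k`, `|B_{k+1}| ≥ γ |W_k|`, the
intersection of the intervals `W_k` is contained in `E`. -/
def IsPairWinning (α γ : ℝ) (E : Set ℝ) : Prop :=
  ∃ σ : WhiteStrategy, σ.Legal α ∧ ∀ B : ℕ → GameInterval,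
    (∀ k, (B (k + 1)).toSet ⊆ (σ.answer B k).toSet ∧
      γ * (σ.answer B k).length ≤ (B (k + 1)).length) →
    ⋂ k, (σ.answer B k).toSet ⊆ E

/-- `E` is `α`-winning: it is `(α, γ)`-winning for every `γ ∈ (0, 1)`. -/
def IsAlphaWinning (α : ℝ) (E : Set ℝ) : Prop :=
  ∀ γ : ℝ, 0 < γ → γ < 1 → IsPairWinning α γ E

end

/-!
Write `K = π_β (X)`, `f = f_β`. White wins by keeping the orbit of the outcome at a positive
distance from `K`. The game is observed through branches: White's interval `W` comes with a number
`n` such that `f^n` is affine on `W`, and it is the image `f^n (W)` that has to be controlled. If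
the image is away from `K`, then so are the images under the earlier iterates
(`IsBranch.le_dist_betaProj`): `X` is invariant under the shift, so distances to `K` pull back
along a branch, as long as the images stay away from the end points `0` and `1`, and this is
ensured by passing to the middle half of an interval.

Given Black's interval, iterate `f` until a discontinuity cuts the image (`exists_large_side`). If
at least half of the interval lies on the right of the cut, that part is sent to a neighbourhood
of `0`, which expands without further cuts until it covers `[0, 1)`, and White chooses the preimage
of a fixed interval away from `K` (`exists_lands`). If at least half lies on the left, that part is
sent onto some `[1 - u, 1)`. What happens next depends on the quasi-greedy expansion `e` of `1`
(`leftDigits`), the largest sequence of `S_β`.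

* If `e ∉ X`, then `K` stays away from `1` (`exists_gap_near_one`), and White may take the image
  `[1 - u, 1 - u / 2]`, even if `u` is small. The image lengths stay bounded below during the game:
  close to `1` the iterate `f^M` has no discontinuity, so the next cut comes after an expansion by
  at least `β ^ M`, which outweighs the factor `γ` lost to Black when `M` is large. The lower bound
  depends on `γ`, but the proportion `α` kept by White does not (`isAlphaWinning_of_gap`).

* If `e ∈ X`, then `e` is the largest sequence of a subshift of finite type, so the left orbit of `1`
  is finite and hence bounded away from `0` (`exists_pos_le_leftOrbit`). Therefore the next cut
  of `[1 - u, 1)` has a right part of definite proportion (`exists_cut_near_one`), and White proceeds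
  as before. The fixed interval away from `K` is part of the cylinder of a word of `S_β` that does
  not occur in `X` (`exists_hole`, `isAlphaWinning_of_le_leftOrbit`).
-/

/-! ### The left orbit of `1` -/

/-- The left orbit of `1`: `leftOrbit β n` is the left limit of the `n`-th iterate of the
beta-transformation at `1`. Taking left limits keeps all the terms positive. -/
noncomputable def leftOrbit (β : ℝ) : ℕ → ℝ
  | 0 => 1
  | n + 1 => β * leftOrbit β n - ((⌈β * leftOrbit β n⌉₊ - 1 : ℕ) : ℝ)

/-- The digits of the left orbit of `1`, that is, the quasi-greedy expansion of `1` in base `β`. -/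
noncomputable def leftDigits (β : ℝ) (n : ℕ) : ℕ := ⌈β * leftOrbit β n⌉₊ - 1

lemma leftOrbit_succ (β : ℝ) (n : ℕ) :
    leftOrbit β (n + 1) = β * leftOrbit β n - leftDigits β n := rfl

lemma leftOrbit_mem {β : ℝ} (hβ : 1 < β) (n : ℕ) : 0 < leftOrbit β n ∧ leftOrbit β n ≤ 1 := by
  induction n with
  | zero => simp [leftOrbit]
  | succ n ih =>
    have hv : 0 < β * leftOrbit β n := mul_pos (by linarith) ih.1
    have h1 : 1 ≤ ⌈β * leftOrbit β n⌉₊ := Nat.one_le_iff_ne_zero.2 (Nat.ceil_pos.2 hv).ne'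
    have h2 := Nat.ceil_lt_add_one hv.le
    have h3 := Nat.le_ceil (β * leftOrbit β n)
    simp only [leftOrbit, Nat.cast_sub h1, Nat.cast_one]
    constructor <;> linarith

/-! ### Orbits and digits -/

lemma betaMap_eq {β x : ℝ} {k : ℕ} (h₁ : (k : ℝ) ≤ β * x) (h₂ : β * x < k + 1) :
    betaMap β x = β * x - k := by
  have : ⌊β * x⌋ = (k : ℤ) := by
    rw [Int.floor_eq_iff]; exact ⟨by exact_mod_cast h₁, by exact_mod_cast h₂⟩
  rw [betaMap, Int.fract, this]; simp

lemma betaMap_mem (β x : ℝ) : betaMap β x ∈ Ico (0 : ℝ) 1 :=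
  ⟨Int.fract_nonneg _, Int.fract_lt_one _⟩

lemma iterate_betaMap_mem {β x : ℝ} (hx : x ∈ Ico (0 : ℝ) 1) (n : ℕ) :
    (betaMap β)^[n] x ∈ Ico (0 : ℝ) 1 := by
  cases n with
  | zero => simpa using hx
  | succ n => rw [Function.iterate_succ_apply']; exact betaMap_mem _ _

lemma mul_iterate_betaMap {β x : ℝ} (hβ : 1 < β) (hx : x ∈ Ico (0 : ℝ) 1) (n : ℕ) :
    β * (betaMap β)^[n] x = betaDigits β x n + (betaMap β)^[n + 1] x := by
  have h0 : 0 ≤ β * (betaMap β)^[n] x :=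
    mul_nonneg (by linarith) (iterate_betaMap_mem hx n).1
  rw [Function.iterate_succ_apply', betaDigits,
    betaMap_eq (Nat.floor_le h0) (Nat.lt_floor_add_one _)]
  ring

lemma betaDigits_iterate (β x : ℝ) (n k : ℕ) :
    betaDigits β ((betaMap β)^[n] x) k = betaDigits β x (n + k) := by
  rw [betaDigits, betaDigits, ← Function.iterate_add_apply, add_comm]

/-- Unrolling the recursion `β r_k = s_k + r_{k+1}`. -/
lemma expansion_of_recursion {β : ℝ} (hβ : 1 < β) {r : ℕ → ℝ} {s : ℕ → ℕ}
    (h : ∀ k, β * r k = s k + r (k + 1)) (n : ℕ) :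
    r 0 = ∑ k ∈ Finset.range n, (s k : ℝ) / β ^ (k + 1) + r n / β ^ n := by
  have hb : β ≠ 0 := by linarith
  induction n with
  | zero => simp
  | succ n ih =>
    have h' : r n = (s n + r (n + 1)) / β := by rw [← h n]; field_simp
    rw [ih, Finset.sum_range_succ, h']
    field_simp
    ring

/-! ### The projection of the beta-shift -/

/-- A sequence of the beta-shift starts like the digit sequence of some point of `[0, 1)`,
up to any given length. -/
lemma exists_prefix_of_mem_betaShift {β : ℝ} {s : ℕ → ℕ} (hs : s ∈ betaShift β) (n : ℕ) :
    ∃ x ∈ Ico (0 : ℝ) 1, ∀ k < n, betaDigits β x k = s k := by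
  obtain ⟨t, ht, x, hx, rfl⟩ := mem_closure_iff.1 hs (PiNat.cylinder s n)
    (PiNat.isOpen_cylinder _ s n) (PiNat.self_mem_cylinder s n)
  exact ⟨x, hx, fun k hk => ht k hk⟩

lemma sum_range_le_one_of_mem_betaShift {β : ℝ} (hβ : 1 < β) {s : ℕ → ℕ} (hs : s ∈ betaShift β)
    (n : ℕ) : ∑ k ∈ Finset.range n, (s k : ℝ) / β ^ (k + 1) ≤ 1 := by
  obtain ⟨x, hx, hd⟩ := exists_prefix_of_mem_betaShift hs n
  have h := expansion_of_recursion hβ (mul_iterate_betaMap hβ hx) n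
  have h2 : 0 ≤ (betaMap β)^[n] x / β ^ n :=
    div_nonneg (iterate_betaMap_mem hx n).1 (pow_nonneg (by linarith) _)
  rw [Finset.sum_congr rfl fun k hk => by rw [← hd k (Finset.mem_range.1 hk)]]
  have := hx.2
  simp only [Function.iterate_zero, id_eq] at h
  linarith

lemma summable_of_mem_betaShift {β : ℝ} (hβ : 1 < β) {s : ℕ → ℕ} (hs : s ∈ betaShift β) :
    Summable fun k => (s k : ℝ) / β ^ (k + 1) :=
  summable_of_sum_range_le (fun k => div_nonneg (Nat.cast_nonneg _) (pow_nonneg (by linarith) _))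
    (sum_range_le_one_of_mem_betaShift hβ hs)

lemma betaProj_mem {β : ℝ} (hβ : 1 < β) {s : ℕ → ℕ} (hs : s ∈ betaShift β) :
    betaProj β s ∈ Icc (0 : ℝ) 1 := by
  have h0 : ∀ k, 0 ≤ (s k : ℝ) / β ^ (k + 1) := fun k =>
    div_nonneg (Nat.cast_nonneg _) (pow_nonneg (by linarith) _)
  exact ⟨tsum_nonneg h0,
    Real.tsum_le_of_sum_range_le h0 (sum_range_le_one_of_mem_betaShift hβ hs)⟩

lemma betaProj_eq_sum_add {β : ℝ} (hβ : 1 < β) {s : ℕ → ℕ} (hs : s ∈ betaShift β) (n : ℕ) :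
    betaProj β s = ∑ k ∈ Finset.range n, (s k : ℝ) / β ^ (k + 1) +
      betaProj β (fun k => s (n + k)) / β ^ n := by
  have hb : β ≠ 0 := by linarith
  rw [betaProj, ← (summable_of_mem_betaShift hβ hs).sum_add_tsum_nat_add n, betaProj,
    ← tsum_div_const]
  congr 1
  refine tsum_congr fun k => ?_
  rw [add_comm k n]
  field_simp
  ring

/-- A point `π_β (s)` is approximated by points whose digits start like `s`. -/
lemma exists_prefix_near_betaProj {β : ℝ} (hβ : 1 < β) {X : Set (ℕ → ℕ)} (hXβ : X ⊆ betaShift β)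
    (hX : ∀ s ∈ X, ∀ n, (fun k => s (n + k)) ∈ X) {s : ℕ → ℕ} (hs : s ∈ X) {δ : ℝ} (hδ : 0 < δ)
    (N : ℕ) : ∃ x ∈ Ico (0 : ℝ) 1, |betaProj β s - x| < δ ∧ ∀ k < N, betaDigits β x k = s k := by
  obtain ⟨m, hm⟩ := pow_unbounded_of_one_lt (1 / δ) hβ
  set n := max m N
  have hn : 1 / δ < β ^ n := hm.trans_le (pow_le_pow_right₀ hβ.le (le_max_left _ _))
  have hpos : 0 < β ^ n := pow_pos (by linarith) _
  obtain ⟨x, hx, hd⟩ := exists_prefix_of_mem_betaShift (hXβ hs) n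
  refine ⟨x, hx, ?_, fun k hk => hd k (hk.trans_le (le_max_right _ _))⟩
  have h1 := expansion_of_recursion hβ (mul_iterate_betaMap hβ hx) n
  rw [Finset.sum_congr rfl fun k hk => by rw [hd k (Finset.mem_range.1 hk)]] at h1
  simp only [Function.iterate_zero, id_eq] at h1
  have h2 := iterate_betaMap_mem (β := β) hx n
  have h3 := betaProj_mem hβ (hXβ (hX s hs n))
  rw [betaProj_eq_sum_add hβ (hXβ hs) n, h1, add_sub_add_left_eq_sub, ← sub_div, abs_div,
    abs_of_pos hpos, div_lt_iff₀ hpos]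
  have : 1 < δ * β ^ n := by rwa [div_lt_iff₀' hδ] at hn
  refine lt_of_le_of_lt ?_ this
  rw [abs_le]
  constructor <;> linarith [h2.1, h2.2, h3.1, h3.2]

/-- Distances to `π_β (X)` shrink at most by the factor `β` under an inverse branch, provided the
image point stays away from `0` and `1`: the margin handles the points of `π_β (X)` that lie in a
neighbouring branch. -/
lemma le_dist_betaProj_of_betaMap {β : ℝ} (hβ : 1 < β) {X : Set (ℕ → ℕ)} (hXβ : X ⊆ betaShift β)
    (hX : ∀ s ∈ X, ∀ n, (fun k => s (n + k)) ∈ X) {x ρ : ℝ} (hx : x ∈ Ico (0 : ℝ) 1)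
    (h₀ : ρ ≤ betaMap β x) (h₁ : betaMap β x ≤ 1 - ρ)
    (h : ∀ κ ∈ betaProj β '' X, ρ ≤ |betaMap β x - κ|) :
    ∀ κ ∈ betaProj β '' X, ρ / β ≤ |x - κ| := by
  rintro _ ⟨s, hs, rfl⟩
  have hb : 0 < β := by linarith
  have hx' := mul_iterate_betaMap hβ hx 0
  simp only [Function.iterate_zero, id_eq, zero_add, Function.iterate_one] at hx'
  have hs' := betaProj_eq_sum_add hβ (hXβ hs) 1
  have ht := hX s hs 1
  have hπ := betaProj_mem hβ (hXβ ht)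
  have hκ := h _ ⟨_, ht, rfl⟩
  set π' := betaProj β (fun k => s (1 + k))
  simp only [Finset.range_one, Finset.sum_singleton, zero_add, pow_one] at hs'
  rw [hs', div_le_iff₀ hb]
  have e : |x - (↑(s 0) / β + π' / β)| * β = |(betaDigits β x 0 : ℝ) - s 0 + (betaMap β x - π')| := by
    rw [← abs_of_pos hb, ← abs_mul, abs_of_pos hb]
    congr 1
    field_simp
    linarith
  rw [e]
  rcases lt_trichotomy (betaDigits β x 0) (s 0) with hlt | heq | hgt
  · have : (betaDigits β x 0 : ℝ) + 1 ≤ s 0 := by exact_mod_cast hlt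
    rw [le_abs]; right; linarith [hπ.1]
  · rw [heq, sub_self, zero_add]; exact hκ
  · have : (s 0 : ℝ) + 1 ≤ betaDigits β x 0 := by exact_mod_cast hgt
    rw [le_abs]; left; linarith [hπ.2]

/-! ### One-sided continuity of digits -/

/-- Close enough to `1`, the orbit of a point shadows the left orbit of `1`. -/
lemma iterate_betaMap_eq_of_near_one {β : ℝ} (hβ : 1 < β) {x : ℝ} (hx : x < 1) {m : ℕ}
    (h : ∀ i ≤ m, β ^ i * (1 - x) ≤ leftOrbit β i) :
    ∀ i ≤ m, (betaMap β)^[i] x = leftOrbit β i - β ^ i * (1 - x) := by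
  intro i
  induction i with
  | zero => intro _; simp [leftOrbit]
  | succ i ih =>
    intro hi
    have h1 := h (i + 1) hi
    have h2 : 0 < β ^ (i + 1) * (1 - x) := mul_pos (pow_pos (by linarith) _) (by linarith)
    have h3 := (leftOrbit_mem hβ (i + 1)).2
    have e : β * (leftOrbit β i - β ^ i * (1 - x)) =
        leftDigits β i + (leftOrbit β (i + 1) - β ^ (i + 1) * (1 - x)) := by
      rw [leftOrbit_succ]; ring
    rw [Function.iterate_succ_apply', ih (by omega),
      betaMap_eq (k := leftDigits β i) (by rw [e]; linarith) (by rw [e]; linarith), e]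
    ring

lemma betaDigits_eq_of_near_one {β : ℝ} (hβ : 1 < β) {x : ℝ} (hx : x < 1) {m : ℕ}
    (h : ∀ i ≤ m, β ^ i * (1 - x) ≤ leftOrbit β i) :
    ∀ i < m, betaDigits β x i = leftDigits β i := by
  intro i hi
  rw [betaDigits, iterate_betaMap_eq_of_near_one hβ hx h i hi.le]
  have h1 := h (i + 1) hi
  have h2 : 0 < β ^ (i + 1) * (1 - x) := mul_pos (pow_pos (by linarith) _) (by linarith)
  have h3 := (leftOrbit_mem hβ (i + 1)).2
  have e : β * (leftOrbit β i - β ^ i * (1 - x)) =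
      leftDigits β i + (leftOrbit β (i + 1) - β ^ (i + 1) * (1 - x)) := by
    rw [leftOrbit_succ]; ring
  rw [e, Nat.floor_eq_iff (by
    have : (0 : ℝ) ≤ leftDigits β i := Nat.cast_nonneg _
    linarith)]
  constructor <;> linarith

/-- Every finite stretch of the left orbit of `1` is shadowed on a left neighbourhood of `1`. -/
lemma exists_near_one {β : ℝ} (hβ : 1 < β) (m : ℕ) :
    ∃ η > 0, ∀ i ≤ m, β ^ i * η ≤ leftOrbit β i := by
  induction m with
  | zero => exact ⟨1, one_pos, by simp [leftOrbit]⟩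
  | succ m ih =>
    obtain ⟨η, hη, h⟩ := ih
    have hp : 0 < β ^ (m + 1) := pow_pos (by linarith) _
    have hc := (leftOrbit_mem hβ (m + 1)).1
    refine ⟨min η (leftOrbit β (m + 1) / β ^ (m + 1)), lt_min hη (div_pos hc hp), fun i hi => ?_⟩
    rcases Nat.le_succ_iff.1 hi with hi | rfl
    · exact (mul_le_mul_of_nonneg_left (min_le_left _ _) (pow_nonneg (by linarith) _)).trans (h i hi)
    · rw [← le_div_iff₀' hp]; exact min_le_right _ _

/-- The digits are right-continuous functions of the point. -/
lemma exists_betaDigits_eq_right {β : ℝ} (hβ : 1 < β) {y : ℝ} (hy : y ∈ Ico (0 : ℝ) 1) (N : ℕ) :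
    ∃ η > 0, y + η ≤ 1 ∧ ∀ z ∈ Ico y (y + η),
      (∀ i < N, betaDigits β z i = betaDigits β y i) ∧
        (betaMap β)^[N] z = (betaMap β)^[N] y + β ^ N * (z - y) := by
  induction N with
  | zero => exact ⟨1 - y, by linarith [hy.2], by linarith, fun z _ => by simp⟩
  | succ N ih =>
    obtain ⟨η, hη, hη1, h⟩ := ih
    have hp : 0 < β ^ (N + 1) := pow_pos (by linarith) _
    have hlt := (iterate_betaMap_mem (β := β) hy (N + 1)).2
    obtain ⟨η', hη', h₁, h₂⟩ : ∃ η' > 0, η' ≤ η ∧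
        η' ≤ (1 - (betaMap β)^[N + 1] y) / β ^ (N + 1) :=
      ⟨_, lt_min hη (div_pos (by linarith) hp), min_le_left _ _, min_le_right _ _⟩
    refine ⟨η', hη', by linarith, fun z hz => ?_⟩
    obtain ⟨h1, h2⟩ := h z ⟨hz.1, hz.2.trans_le (by linarith)⟩
    have hz2 : β ^ (N + 1) * (z - y) < 1 - (betaMap β)^[N + 1] y := by
      rw [← lt_div_iff₀' hp]
      linarith [hz.2]
    have hz1 : 0 ≤ β ^ (N + 1) * (z - y) := mul_nonneg hp.le (by linarith [hz.1])
    have h0 := (iterate_betaMap_mem (β := β) hy (N + 1)).1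
    have e : β * (betaMap β)^[N] z =
        betaDigits β y N + ((betaMap β)^[N + 1] y + β ^ (N + 1) * (z - y)) := by
      rw [h2, mul_add, mul_iterate_betaMap hβ hy]; ring
    constructor
    · intro i hi
      rcases Nat.lt_succ_iff_lt_or_eq.1 hi with hi | rfl
      · exact h1 i hi
      · rw [betaDigits, e, Nat.floor_eq_iff (by
          have : (0 : ℝ) ≤ betaDigits β y i := Nat.cast_nonneg _
          linarith)]
        constructor <;> linarith
    · rw [Function.iterate_succ_apply' _ N z,
        betaMap_eq (k := betaDigits β y N) (by rw [e]; linarith) (by rw [e]; linarith), e]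
      ring

/-! ### Subshifts of finite type -/

lemma occursAt_shift {w : List ℕ} {s : ℕ → ℕ} {n m : ℕ} :
    OccursAt w (fun k => s (n + k)) m ↔ OccursAt w s (n + m) := by
  simp [OccursAt, add_assoc]

lemma OccursAt.congr {w : List ℕ} {s t : ℕ → ℕ} {n m : ℕ}
    (h : ∀ i < w.length, t (m + i) = s (n + i)) (hs : OccursAt w s n) : OccursAt w t m :=
  fun i => (h i i.2).trans (hs i)

lemma IsSubshiftOfFiniteType.shift_mem {X : Set (ℕ → ℕ)} (hX : IsSubshiftOfFiniteType X) :
    ∀ s ∈ X, ∀ n, (fun k => s (n + k)) ∈ X := by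
  obtain ⟨m, F, rfl⟩ := hX
  rintro s ⟨h₁, h₂⟩ n
  exact ⟨fun k => h₁ _, fun w hw k hk => h₂ w hw _ (occursAt_shift.1 hk)⟩

/-- The complement of a subshift of finite type is open. -/
lemma IsSubshiftOfFiniteType.exists_prefix_ne {X : Set (ℕ → ℕ)} (hX : IsSubshiftOfFiniteType X)
    {e : ℕ → ℕ} (he : e ∉ X) : ∃ N, ∀ s ∈ X, ∃ k < N, s k ≠ e k := by
  obtain ⟨m, F, rfl⟩ := hX
  by_cases h : ∀ k, e k < m
  · simp only [mem_ofPred_eq, not_and, not_forall, not_not] at he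
    obtain ⟨w, hw, n, hn⟩ := he h
    refine ⟨n + w.length, fun s hs => ?_⟩
    by_contra! hc
    exact hs.2 w hw n (hn.congr fun i hi => hc _ (by omega))
  · push Not at h
    obtain ⟨k, hk⟩ := h
    exact ⟨k + 1, fun s hs => ⟨k, by omega, fun hsk => by have := hs.1 k; omega⟩⟩

/-- In a subshift of finite type, the tail of a sequence may be replaced by any sequence that
agrees with it on a window of a fixed length `N`. -/
lemma IsSubshiftOfFiniteType.exists_splice {X : Set (ℕ → ℕ)} (hX : IsSubshiftOfFiniteType X) :
    ∃ m N, (∀ s ∈ X, ∀ k, s k < m) ∧ ∀ s ∈ X, ∀ t ∈ X, ∀ i, (∀ k < N, s (i + k) = t k) →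
      (fun k => if k < i then s k else t (k - i)) ∈ X := by
  obtain ⟨m, F, rfl⟩ := hX
  refine ⟨m, F.sup List.length, fun s hs => hs.1, fun s hs t ht i hst => ⟨fun k => ?_, ?_⟩⟩
  · dsimp only
    split_ifs
    exacts [hs.1 _, ht.1 _]
  · intro w hw n hn
    have hlen : w.length ≤ F.sup List.length := Finset.le_sup (f := List.length) hw
    -- A word that starts before the junction lies inside the common window.
    by_cases hni : n < i
    · refine hs.2 w hw n (hn.congr fun j hj => ?_)
      split_ifs with h
      · rfl
      · have := hst (n + j - i) (by omega)
        rw [← this]; congr 1; omega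
    · refine ht.2 w hw (n - i) (hn.congr fun j hj => ?_)
      rw [if_neg (by omega)]; congr 1; omega

lemma betaProj_leftDigits {β : ℝ} (hβ : 1 < β) (i : ℕ) :
    betaProj β (fun k => leftDigits β (i + k)) = leftOrbit β i := by
  have hb : 0 < β := by linarith
  refine HasSum.tsum_eq ((hasSum_iff_tendsto_nat_of_nonneg (fun k =>
    div_nonneg (Nat.cast_nonneg _) (pow_nonneg hb.le _)) _).2 ?_)
  have h := expansion_of_recursion hβ (r := fun k => leftOrbit β (i + k))
    (s := fun k => leftDigits β (i + k)) (fun k => by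
      rw [← add_assoc, leftOrbit_succ]; ring)
  have h' : ∀ n, ∑ k ∈ Finset.range n, (leftDigits β (i + k) : ℝ) / β ^ (k + 1) =
      leftOrbit β i - leftOrbit β (i + n) / β ^ n := fun n => by
    have := h n
    simp only [add_zero] at this
    linarith
  simp only [h']
  have hlim : Filter.Tendsto (fun n => leftOrbit β (i + n) / β ^ n) Filter.atTop (nhds 0) := by
    refine squeeze_zero (fun n => div_nonneg (leftOrbit_mem hβ _).1.le (pow_nonneg hb.le _))
      (fun n => ?_) (tendsto_pow_atTop_nhds_zero_of_lt_one (inv_nonneg.2 hb.le)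
        (inv_lt_one_of_one_lt₀ hβ))
    rw [inv_pow, ← one_div]
    exact div_le_div_of_nonneg_right (leftOrbit_mem hβ _).2 (pow_nonneg hb.le _)
  simpa using hlim.const_sub (leftOrbit β i)

/-- If a subshift of finite type inside the beta-shift contains the quasi-greedy expansion of `1`,
then the left orbit of `1` is bounded away from `0`. The quasi-greedy expansion is the largest
sequence of the beta-shift, so splicing it with its own tails cannot increase it; therefore
`leftOrbit β i` depends only on a window of bounded length, and the left orbit is finite. -/
lemma exists_pos_le_leftOrbit {β : ℝ} (hβ : 1 < β) {X : Set (ℕ → ℕ)}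
    (hX : IsSubshiftOfFiniteType X) (hXβ : X ⊆ betaShift β) (he : leftDigits β ∈ X) :
    ∃ c > 0, ∀ i, c ≤ leftOrbit β i := by
  have hb : 0 < β := by linarith
  obtain ⟨m, N, hm, hsp⟩ := hX.exists_splice
  have hle : ∀ i j, (∀ k < N, leftDigits β (i + k) = leftDigits β (j + k)) →
      leftOrbit β j ≤ leftOrbit β i := by
    intro i j hij
    have hmem := hXβ (hsp _ he _ (hX.shift_mem _ he j) i hij)
    have h1 := (betaProj_mem hβ hmem).2
    have h2 := betaProj_leftDigits hβ 0
    simp only [zero_add] at h2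
    rw [betaProj_eq_sum_add hβ (hXβ he) i, betaProj_leftDigits hβ] at h2
    rw [betaProj_eq_sum_add hβ hmem i, Finset.sum_congr rfl fun k hk => by
      rw [if_pos (Finset.mem_range.1 hk)]] at h1
    simp only [add_tsub_cancel_left, add_lt_iff_neg_left, not_lt_zero, ite_false,
      betaProj_leftDigits hβ] at h1
    have h3 : leftOrbit β 0 = 1 := rfl
    rw [h3] at h2
    exact (div_le_div_iff_of_pos_right (pow_pos hb i)).1 (by linarith)
  have hfac : Function.FactorsThrough (leftOrbit β)
      (fun i (k : Fin N) => (⟨leftDigits β (i + k), hm _ he _⟩ : Fin m)) := by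
    intro i j hij
    have hij' : ∀ k < N, leftDigits β (i + k) = leftDigits β (j + k) := fun k hk => by
      simpa using congrFun hij ⟨k, hk⟩
    exact le_antisymm (hle j i fun k hk => (hij' k hk).symm) (hle i j hij')
  have hfin : (range (leftOrbit β)).Finite := by
    refine (Set.finite_range (Function.extend (fun i (k : Fin N) =>
      (⟨leftDigits β (i + k), hm _ he _⟩ : Fin m)) (leftOrbit β) 0)).subset ?_
    rintro _ ⟨i, rfl⟩
    exact ⟨_, hfac.extend_apply _ i⟩
  obtain ⟨_, ⟨i, rfl⟩, hi⟩ := Set.exists_min_image _ id hfin (range_nonempty _)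
  exact ⟨leftOrbit β i, (leftOrbit_mem hβ i).1, fun j => hi _ ⟨j, rfl⟩⟩

/-! ### Intervals that avoid the projection of the subshift -/

/-- If a subshift of finite type inside the beta-shift does not contain the quasi-greedy
expansion of `1`, then its projection stays away from `1`. -/
lemma exists_gap_near_one {β : ℝ} (hβ : 1 < β) {X : Set (ℕ → ℕ)}
    (hX : IsSubshiftOfFiniteType X) (hXβ : X ⊆ betaShift β) (he : leftDigits β ∉ X) :
    ∃ η > 0, ∀ κ ∈ betaProj β '' X, κ ≤ 1 - η := by
  obtain ⟨N, hN⟩ := hX.exists_prefix_ne he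
  obtain ⟨η, hη, h⟩ := exists_near_one hβ N
  refine ⟨η / 2, by positivity, ?_⟩
  rintro _ ⟨s, hs, rfl⟩
  by_contra! hlt
  obtain ⟨x, hx, hd, hxs⟩ :=
    exists_prefix_near_betaProj hβ hXβ hX.shift_mem hs (half_pos hη) N
  obtain ⟨k, hk, hne⟩ := hN s hs
  refine hne ((hxs k hk).symm.trans (betaDigits_eq_of_near_one hβ hx.2 (fun i hi => ?_) k hk))
  refine (mul_le_mul_of_nonneg_left ?_ (pow_nonneg (by linarith) _)).trans (h i hi)
  linarith [(abs_lt.1 hd).2]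

/-- A word of the beta-shift that does not occur in `X` gives an interval away from
`π_β (X)`: the interior of the cylinder of the word. -/
lemma exists_hole {β : ℝ} (hβ : 1 < β) {X : Set (ℕ → ℕ)}
    (hX : ∀ s ∈ X, ∀ n, (fun k => s (n + k)) ∈ X) (hXβ : X ⊆ betaShift β) {w : List ℕ}
    (hw : w ∈ language (betaShift β)) (hwX : w ∉ language X) :
    ∃ x₁ x₂ ρ : ℝ, 0 < x₁ ∧ x₁ < x₂ ∧ x₂ < 1 ∧ 0 < ρ ∧
      ∀ x ∈ Icc x₁ x₂, ∀ κ ∈ betaProj β '' X, ρ ≤ |x - κ| := by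
  obtain ⟨s, hs, n, hsn⟩ := hw
  obtain ⟨x, hx, hxs⟩ := exists_prefix_of_mem_betaShift hs (n + w.length)
  have hy := iterate_betaMap_mem (β := β) hx n
  set y := (betaMap β)^[n] x with hydef
  obtain ⟨η, hη, hη1, h⟩ := exists_betaDigits_eq_right hβ hy w.length
  have hout : ∀ κ ∈ betaProj β '' X, κ ≤ y ∨ y + η ≤ κ := by
    rintro _ ⟨t, ht, rfl⟩
    by_contra! hc
    obtain ⟨z, hz, hzd, hzt⟩ := exists_prefix_near_betaProj hβ hXβ hX ht
      (lt_min (sub_pos.2 hc.1) (sub_pos.2 hc.2)) w.length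
    have hz1 := abs_lt.1 (hzd.trans_le (min_le_left _ _))
    have hz2 := abs_lt.1 (hzd.trans_le (min_le_right _ _))
    obtain ⟨hd, -⟩ := h z ⟨by linarith, by linarith⟩
    refine hwX ⟨t, ht, 0, hsn.congr fun i hi => ?_⟩
    rw [zero_add, ← hzt i hi, hd i hi, hydef, betaDigits_iterate, hxs _ (by omega)]
  refine ⟨y + η / 3, y + 2 * η / 3, η / 3, by linarith [hy.1], by linarith, by linarith,
    by positivity, fun x hx κ hκ => ?_⟩
  rw [le_abs]
  rcases hout κ hκ with h | h
  · left; linarith [hx.1]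
  · right; linarith [hx.2]

/-! ### Branches of the iterates -/

/-- The iterates `f_β^i`, `i ≤ n`, are affine on `S` (with slope `β ^ i`). -/
def IsBranch (β : ℝ) (n : ℕ) (S : Set ℝ) : Prop :=
  ∀ i ≤ n, ∃ q : ℝ, ∀ x ∈ S, (betaMap β)^[i] x = β ^ i * x - q

lemma IsBranch.mono {β : ℝ} {n m : ℕ} {S T : Set ℝ} (h : IsBranch β n S) (hmn : m ≤ n)
    (hTS : T ⊆ S) : IsBranch β m T := fun i hi =>
  let ⟨q, hq⟩ := h i (hi.trans hmn)
  ⟨q, fun x hx => hq x (hTS hx)⟩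

lemma IsBranch.extend {β : ℝ} {n m : ℕ} {S : Set ℝ} (h : IsBranch β n S)
    (h' : ∀ i, n ≤ i → i ≤ m → ∃ q : ℝ, ∀ x ∈ S, (betaMap β)^[i] x = β ^ i * x - q) :
    IsBranch β m S := fun i hi =>
  if hin : i ≤ n then h i hin else h' i (by omega) hi

lemma iterate_betaMap_mem_Icc {β x : ℝ} (hx : x ∈ Icc (0 : ℝ) 1) (n : ℕ) :
    (betaMap β)^[n] x ∈ Icc (0 : ℝ) 1 := by
  cases n with
  | zero => simpa using hx
  | succ n => rw [Function.iterate_succ_apply']; exact Ico_subset_Icc_self (betaMap_mem _ _)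

lemma IsBranch.length_le {β a b : ℝ} {n : ℕ} (ha : 0 ≤ a) (hab : a < b) (hb : b ≤ 1)
    (h : IsBranch β n (Icc a b)) : β ^ n * (b - a) ≤ 1 := by
  obtain ⟨q, hq⟩ := h n le_rfl
  have h1 := hq a (left_mem_Icc.2 hab.le)
  have h2 := hq b (right_mem_Icc.2 hab.le)
  have h3 := (iterate_betaMap_mem_Icc (β := β) (x := a) ⟨ha, by linarith⟩ n).1
  have h4 := (iterate_betaMap_mem_Icc (β := β) (x := b) ⟨by linarith, hb⟩ n).2
  rw [mul_sub]
  linarith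

/-- An interval is eventually cut by a discontinuity. -/
lemma exists_maximal_branch {β a b : ℝ} (hβ : 1 < β) (ha : 0 ≤ a) (hab : a < b) (hb : b ≤ 1) :
    ∃ j, IsBranch β j (Icc a b) ∧ ¬ IsBranch β (j + 1) (Icc a b) := by
  classical
  have hex : ∃ n, ¬ IsBranch β n (Icc a b) := by
    obtain ⟨n, hn⟩ := pow_unbounded_of_one_lt (1 / (b - a)) hβ
    refine ⟨n, fun h => ?_⟩
    have := h.length_le ha hab hb
    rw [div_lt_iff₀ (by linarith)] at hn
    linarith
  have h0 : Nat.find hex ≠ 0 := by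
    rw [Ne, Nat.find_eq_zero, not_not]
    intro i hi
    obtain rfl : i = 0 := by omega
    exact ⟨0, by simp⟩
  obtain ⟨j, hj⟩ := Nat.exists_eq_succ_of_ne_zero h0
  refine ⟨j, not_not.1 (Nat.find_min hex (by omega)), ?_⟩
  rw [← Nat.succ_eq_add_one, ← hj]
  exact Nat.find_spec hex

/-- The first cut of an interval: the point `p` is sent to a discontinuity, the part on its left
is sent onto a left neighbourhood of `1` and the part on its right to a right neighbourhood
of `0`. -/
lemma exists_cut {β a b : ℝ} (hβ : 1 < β) {j : ℕ}
    (h : IsBranch β j (Icc a b)) (hn : ¬ IsBranch β (j + 1) (Icc a b)) :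
    ∃ p, a < p ∧ p ≤ b ∧ β ^ (j + 1) * (p - a) ≤ 1 ∧
      (∀ x ∈ Ico a p, (betaMap β)^[j + 1] x = 1 - β ^ (j + 1) * (p - x)) ∧
      ∀ x ∈ Icc p b, β ^ (j + 1) * (x - p) < 1 →
        (betaMap β)^[j + 1] x = β ^ (j + 1) * (x - p) := by
  obtain ⟨q, hq⟩ := h j le_rfl
  have hp : 0 < β ^ (j + 1) := pow_pos (by linarith) _
  have hf : ∀ x ∈ Icc a b, (betaMap β)^[j + 1] x = Int.fract (β ^ (j + 1) * x - β * q) := by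
    intro x hx
    rw [Function.iterate_succ_apply', hq x hx, betaMap, pow_succ]
    congr 1; ring
  set k : ℤ := ⌊β ^ (j + 1) * a - β * q⌋ + 1 with hk
  have hk1 : β ^ (j + 1) * a - β * q < k := by rw [hk]; push_cast; exact Int.lt_floor_add_one _
  have hk2 : k - 1 ≤ β ^ (j + 1) * a - β * q := by
    rw [hk]; push_cast; linarith [Int.floor_le (β ^ (j + 1) * a - β * q)]
  obtain ⟨p, hpk⟩ : ∃ p, β ^ (j + 1) * p - β * q = k :=
    ⟨(k + β * q) / β ^ (j + 1), by field_simp; ring⟩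
  have hap : a < p := by
    by_contra! hle
    have := mul_le_mul_of_nonneg_left hle hp.le
    linarith
  have hleft : ∀ x ∈ Icc a b, x < p → (betaMap β)^[j + 1] x = 1 - β ^ (j + 1) * (p - x) := by
    intro x hx hxp
    have h1 := mul_lt_mul_of_pos_left hxp hp
    have h2 := mul_le_mul_of_nonneg_left hx.1 hp.le
    rw [hf x hx, Int.fract_eq_iff]
    refine ⟨by linarith, by linarith, k - 1, ?_⟩
    push_cast
    linarith
  have hpb : p ≤ b := by
    by_contra! hbp
    refine hn (h.extend fun i hi hi' => ?_)
    rcases (by omega : i ≤ j ∨ i = j + 1) with hij | rfl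
    · exact h i hij
    · exact ⟨β ^ (j + 1) * p - 1, fun x hx => by
        rw [hleft x hx (hx.2.trans_lt hbp)]; ring⟩
  refine ⟨p, hap, hpb, by linarith, fun x hx => hleft x ⟨hx.1, hx.2.le.trans hpb⟩ hx.2, ?_⟩
  intro x hx hlt
  rw [hf x ⟨hap.le.trans hx.1, hx.2⟩, Int.fract_eq_iff]
  have h1 := mul_le_mul_of_nonneg_left hx.1 hp.le
  refine ⟨by linarith, hlt, k, ?_⟩
  linarith

/-! ### Expansion near `0` and near `1` -/

/-- A right neighbourhood of `0` expands under the iterates of `f_β` until it covers `[0, 1)`; so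
it contains a subinterval, in controlled proportion, that is sent onto a prescribed
`[x₁, x₂] ⊆ (0, 1)`. Here the neighbourhood of `0` is already the image of `[p, p + L)`
under `f_β^n`. -/
lemma exists_branch_onto {β p L x₁ x₂ : ℝ} (hβ : 1 < β) {n : ℕ} (hL : 0 < L)
    (hx₁ : 0 < x₁) (hx : x₁ < x₂) (hx₂ : x₂ < 1) (h : IsBranch β n (Ico p (p + L)))
    (hf : ∀ x ∈ Ico p (p + L), (betaMap β)^[n] x = β ^ n * (x - p)) :
    ∃ N ≥ n, min (1 / β ^ n) (L / β) ≤ 1 / β ^ N ∧ x₂ / β ^ N < L ∧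
      IsBranch β N (Icc (p + x₁ / β ^ N) (p + x₂ / β ^ N)) ∧
      ∀ x ∈ Icc (p + x₁ / β ^ N) (p + x₂ / β ^ N), (betaMap β)^[N] x = β ^ N * (x - p) := by
  have hb : 0 < β := by linarith
  have hpos : ∀ m : ℕ, 0 < β ^ m := fun m => pow_pos hb m
  obtain ⟨N, hnN, hNL, hN⟩ : ∃ N ≥ n, 1 ≤ β ^ N * L ∧ min (1 / β ^ n) (L / β) ≤ 1 / β ^ N := by
    by_cases hnL : 1 ≤ β ^ n * L
    · exact ⟨n, le_rfl, hnL, min_le_left _ _⟩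
    · push Not at hnL
      have hL1 : L ≤ 1 := by nlinarith [one_le_pow₀ (n := n) hβ.le]
      obtain ⟨N, hN1, hN2⟩ := exists_nat_pow_near (one_le_one_div hL hL1) hβ
      rw [le_div_iff₀ hL] at hN1
      rw [div_lt_iff₀ hL] at hN2
      refine ⟨N + 1, ?_, hN2.le, (min_le_right _ _).trans ?_⟩
      · by_contra! hlt
        have := mul_le_mul_of_nonneg_right (pow_le_pow_right₀ hβ.le hlt.le) hL.le
        linarith
      · rw [div_le_div_iff₀ hb (hpos _), pow_succ]
        nlinarith
  have hx₂N : x₂ / β ^ N < L := by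
    rw [div_lt_iff₀ (hpos N)]; linarith
  have hsub : ∀ x ∈ Icc (p + x₁ / β ^ N) (p + x₂ / β ^ N),
      x ∈ Ico p (p + L) ∧ β ^ N * (x - p) < 1 := by
    intro x hxI
    have h1 : 0 < x₁ / β ^ N := div_pos hx₁ (hpos N)
    refine ⟨⟨by linarith [hxI.1], by linarith [hxI.2]⟩, ?_⟩
    have : x - p ≤ x₂ / β ^ N := by linarith [hxI.2]
    rw [le_div_iff₀ (hpos N)] at this
    linarith
  have hi : ∀ i, n ≤ i → i ≤ N → ∀ x ∈ Icc (p + x₁ / β ^ N) (p + x₂ / β ^ N),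
      (betaMap β)^[i] x = β ^ i * (x - p) := by
    intro i hni hiN x hxI
    obtain ⟨hxp, hx1⟩ := hsub x hxI
    have hlt : ∀ m ≤ N, β ^ m * (x - p) < 1 := fun m hm =>
      (mul_le_mul_of_nonneg_right (pow_le_pow_right₀ hβ.le hm)
        (by linarith [hxp.1])).trans_lt hx1
    induction i, hni using Nat.le_induction with
    | base => exact hf x hxp
    | succ i hni ih =>
      rw [Function.iterate_succ_apply', ih (by omega), betaMap, ← mul_assoc, ← pow_succ',
        Int.fract_eq_self]
      exact ⟨mul_nonneg (hpos _).le (by linarith [hxp.1]), hlt _ hiN⟩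
  refine ⟨N, hnN, hN, hx₂N, ?_, hi N hnN le_rfl⟩
  refine (h.mono le_rfl fun x hxI => (hsub x hxI).1).extend fun i hni hiN =>
    ⟨β ^ i * p, fun x hxI => ?_⟩
  rw [hi i hni hiN x hxI]; ring

/-- If the left orbit of `1` is bounded below by `c > 0`, a left neighbourhood of `1` is cut in such
a way that the right part has an image of length at least `c`. Here the neighbourhood of `1` is
already the image of `[a, p)` under `f_β^n`. -/
lemma exists_cut_near_one {β a p c : ℝ} (hβ : 1 < β) {n : ℕ} (hap : a < p)
    (hc : ∀ i, c ≤ leftOrbit β i) (h1 : β ^ n * (p - a) ≤ 1)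
    (h : IsBranch β n (Ico a p)) (hf : ∀ x ∈ Ico a p, (betaMap β)^[n] x = 1 - β ^ n * (p - x)) :
    ∃ m ≥ n, ∃ p', a < p' ∧ p' < p ∧ c / β ^ m ≤ p - p' ∧ (p - a) / β ≤ 1 / β ^ m ∧
      IsBranch β m (Ico p' p) ∧ ∀ x ∈ Ico p' p, (betaMap β)^[m] x = β ^ m * (x - p') := by
  classical
  have hb : 0 < β := by linarith
  have hpos : ∀ m : ℕ, 0 < β ^ m := fun m => pow_pos hb m
  have hu : 0 < β ^ n * (p - a) := mul_pos (hpos n) (by linarith)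
  have hex : ∃ m, leftOrbit β m < β ^ m * (β ^ n * (p - a)) := by
    obtain ⟨m, hm⟩ := pow_unbounded_of_one_lt (1 / (β ^ n * (p - a))) hβ
    rw [div_lt_iff₀ hu] at hm
    exact ⟨m, (leftOrbit_mem hβ m).2.trans_lt hm⟩
  have h0 : Nat.find hex ≠ 0 := by
    rw [Ne, Nat.find_eq_zero, not_lt]
    simpa [leftOrbit] using h1
  obtain ⟨m, hm⟩ := Nat.exists_eq_succ_of_ne_zero h0
  have hlt : leftOrbit β (m + 1) < β ^ (m + 1) * (β ^ n * (p - a)) := by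
    have := Nat.find_spec hex
    rwa [hm] at this
  have hle : ∀ i ≤ m, β ^ i * (β ^ n * (p - a)) ≤ leftOrbit β i := fun i hi =>
    not_lt.1 (Nat.find_min hex (by omega))
  obtain ⟨hc0, hc1⟩ := leftOrbit_mem hβ (m + 1)
  set M := n + (m + 1) with hM
  have hMpow : β ^ M = β ^ (m + 1) * β ^ n := by rw [hM, pow_add]; ring
  set p' := p - leftOrbit β (m + 1) / β ^ M with hp'
  have hp'p : p' < p := by
    have := div_pos hc0 (hpos M)
    linarith
  have hap' : a < p' := by
    have : leftOrbit β (m + 1) / β ^ M < p - a := by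
      rw [div_lt_iff₀' (hpos M), hMpow]; linarith
    linarith
  have hit : ∀ x ∈ Ico p' p, ∀ i ≤ m + 1,
      (betaMap β)^[n + i] x = leftOrbit β i - β ^ (n + i) * (p - x) := by
    intro x hx i hi
    have hxa : x ∈ Ico a p := ⟨hap'.le.trans hx.1, hx.2⟩
    rw [add_comm, Function.iterate_add_apply, hf x hxa,
      iterate_betaMap_eq_of_near_one hβ (m := m + 1) _ _ i hi]
    · rw [pow_add]; ring
    · have := mul_pos (hpos n) (sub_pos.2 hx.2)
      linarith
    · intro k hk
      rw [sub_sub_cancel]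
      rcases (by omega : k ≤ m ∨ k = m + 1) with hk | rfl
      · refine le_trans (mul_le_mul_of_nonneg_left (mul_le_mul_of_nonneg_left ?_ (hpos n).le)
          (hpos k).le) (hle k hk)
        linarith [hxa.1]
      · have : p - x ≤ leftOrbit β (m + 1) / β ^ M := by linarith [hx.1]
        rw [le_div_iff₀ (hpos M), hMpow] at this
        linarith
  refine ⟨M, by omega, p', hap', hp'p, ?_, ?_, ?_, ?_⟩
  · rw [hp', sub_sub_cancel]
    exact div_le_div_of_nonneg_right (hc _) (hpos _).le
  · have := (hle m le_rfl).trans (leftOrbit_mem hβ m).2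
    rw [div_le_div_iff₀ hb (hpos M), hMpow, pow_succ]
    nlinarith
  · refine (h.mono le_rfl (Ico_subset_Ico_left hap'.le)).extend fun i hni hi => ?_
    obtain ⟨k, rfl⟩ := Nat.exists_eq_add_of_le hni
    exact ⟨β ^ (n + k) * p - leftOrbit β k, fun x hx => by
      rw [hit x hx k (by omega)]; ring⟩
  · intro x hx
    rw [hit x hx (m + 1) le_rfl, ← hM, hp']
    have := (hpos M).ne'
    field_simp
    ring

/-! ### Distance to the projection along a branch -/

/-- The middle half of a branch interval whose last image is away from `π_β (X)` has all its
images away from `π_β (X)`: the margin kept on both sides keeps the images away from `0`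
and `1`, so the distance pulls back. -/
lemma IsBranch.le_dist_betaProj {β : ℝ} (hβ : 1 < β) {X : Set (ℕ → ℕ)} (hXβ : X ⊆ betaShift β)
    (hX : ∀ s ∈ X, ∀ n, (fun k => s (n + k)) ∈ X) {c d ρ : ℝ} {n : ℕ} (hc : 0 ≤ c) (hcd : c < d)
    (hd : d ≤ 1) (hρ : 0 < ρ) (h : IsBranch β n (Icc c d)) {x : ℝ}
    (hx₁ : c + (d - c) / 4 ≤ x) (hx₂ : x ≤ d - (d - c) / 4)
    (hfar : ∀ κ ∈ betaProj β '' X, ρ ≤ |(betaMap β)^[n] x - κ|) :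
    ∀ i ≤ n, ∀ κ ∈ betaProj β '' X, min ρ ((d - c) / 4) * (d - c) ≤ |(betaMap β)^[i] x - κ| := by
  have hb : 0 < β := by linarith
  set μ := min ρ ((d - c) / 4) with hμdef
  have hμ : 0 < μ := lt_min hρ (by linarith)
  have hxd : x ∈ Ico (0 : ℝ) 1 := ⟨by linarith, by linarith⟩
  have hmargin : ∀ i ≤ n, (d - c) / 4 ≤ (betaMap β)^[i] x ∧
      (betaMap β)^[i] x ≤ 1 - (d - c) / 4 := by
    intro i hi
    obtain ⟨q, hq⟩ := h i hi
    have h1 := hq c (left_mem_Icc.2 hcd.le)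
    have h2 := hq d (right_mem_Icc.2 hcd.le)
    have h3 := (iterate_betaMap_mem_Icc (β := β) (x := c) ⟨hc, by linarith⟩ i).1
    have h4 := (iterate_betaMap_mem_Icc (β := β) (x := d) ⟨by linarith, hd⟩ i).2
    have hp : 1 ≤ β ^ i := one_le_pow₀ hβ.le
    rw [hq x ⟨by linarith, by linarith⟩]
    constructor <;> nlinarith
  have key : ∀ i ≤ n, ∀ κ ∈ betaProj β '' X, μ / β ^ i ≤ |(betaMap β)^[n - i] x - κ| := by
    intro i
    induction i with
    | zero =>
      intro _ κ hκ
      rw [pow_zero, div_one, Nat.sub_zero]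
      exact (min_le_left _ _).trans (hfar κ hκ)
    | succ i ih =>
      intro hi κ hκ
      have hs : n - i = (n - (i + 1)) + 1 := by omega
      have hle : μ / β ^ i ≤ (d - c) / 4 :=
        (div_le_self hμ.le (one_le_pow₀ hβ.le)).trans (min_le_right _ _)
      have hm := hmargin (n - i) (by omega)
      have ih' := ih (by omega)
      rw [hs, Function.iterate_succ_apply'] at hm ih'
      rw [pow_succ, ← div_div]
      exact le_dist_betaProj_of_betaMap hβ hXβ hX (iterate_betaMap_mem hxd _)
        (by linarith) (by linarith) ih' κ hκ
  intro i hi κ hκ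
  have hk := key (n - i) (by omega) κ hκ
  rw [Nat.sub_sub_self hi] at hk
  refine le_trans ?_ hk
  rw [le_div_iff₀ (pow_pos hb _), mul_assoc]
  refine mul_le_of_le_one_right hμ.le ?_
  rw [mul_comm]
  exact (h.mono (Nat.sub_le n i) subset_rfl).length_le hc hcd hd

/-! ### Landing on a prescribed interval -/

/-- The iterate `f_β^n` maps `[c, d]` affinely onto `[x₁, x₂]`, and the earlier iterates are
affine on `[c, d]` too. -/
structure Lands (β x₁ x₂ : ℝ) (n : ℕ) (c d : ℝ) : Prop where
  isBranch : IsBranch β n (Icc c d)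
  iterate_eq : ∀ x ∈ Icc c d, (betaMap β)^[n] x = x₁ + β ^ n * (x - c)
  length_eq : β ^ n * (d - c) = x₂ - x₁

/-- The first cut leaves a definite proportion of the interval on one side: either on the left,
where the image is `[1 - u, 1)`, or on the right, where the image is `[0, t)`. -/
lemma exists_large_side {β a b : ℝ} (hβ : 1 < β) (ha : 0 ≤ a) (hab : a < b) (hb : b ≤ 1) :
    ∃ n p, 1 ≤ n ∧ (∀ M, IsBranch β M (Icc a b) → M < n) ∧ a < p ∧ p ≤ b ∧
      ((b - a) / 2 ≤ p - a ∧ β ^ n * (p - a) ≤ 1 ∧ IsBranch β n (Ico a p) ∧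
          (∀ x ∈ Ico a p, (betaMap β)^[n] x = 1 - β ^ n * (p - x)) ∨
        (b - a) / β ≤ 1 / β ^ n ∧ ∃ L > 0, (b - a) / (2 * β) ≤ L ∧ p + L ≤ b ∧
          IsBranch β n (Ico p (p + L)) ∧
          ∀ x ∈ Ico p (p + L), (betaMap β)^[n] x = β ^ n * (x - p)) := by
  have hb0 : 0 < β := by linarith
  obtain ⟨j, hj, hj'⟩ := exists_maximal_branch hβ ha hab hb
  obtain ⟨p, hap, hpb, hu, hl, hr⟩ := exists_cut hβ hj hj'
  have hp : 0 < β ^ (j + 1) := pow_pos hb0 _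
  have hlen := hj.length_le ha hab hb
  have hlen' : (b - a) / β ≤ 1 / β ^ (j + 1) := by
    rw [div_le_div_iff₀ hb0 hp, pow_succ]
    nlinarith
  refine ⟨j + 1, p, by omega, fun M hM => ?_, hap, hpb, ?_⟩
  · by_contra! hlt
    exact hj' (hM.mono hlt subset_rfl)
  have hext : ∀ {S : Set ℝ} (q : ℝ), S ⊆ Icc a b →
      (∀ x ∈ S, (betaMap β)^[j + 1] x = β ^ (j + 1) * x - q) → IsBranch β (j + 1) S := by
    intro S q hS hq
    refine (hj.mono le_rfl hS).extend fun i hi hi' => ?_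
    rcases (by omega : i ≤ j ∨ i = j + 1) with hij | rfl
    · exact (hj.mono le_rfl hS) i hij
    · exact ⟨q, hq⟩
  by_cases hside : (b - a) / 2 ≤ p - a
  · refine Or.inl ⟨hside, hu, hext (β ^ (j + 1) * p - 1)
      (fun x hx => ⟨hx.1, hx.2.le.trans hpb⟩) fun x hx => ?_, hl⟩
    rw [hl x hx]; ring
  · have hbp : (b - a) / 2 < b - p := by linarith
    have hright : ∀ x ∈ Ico p (p + min (b - p) (1 / β ^ (j + 1))),
        (betaMap β)^[j + 1] x = β ^ (j + 1) * (x - p) := by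
      intro x hx
      refine hr x ⟨hx.1, ?_⟩ ?_
      · linarith [hx.2, min_le_left (b - p) (1 / β ^ (j + 1))]
      · rw [← lt_div_iff₀' hp]
        linarith [hx.2, min_le_right (b - p) (1 / β ^ (j + 1))]
    refine Or.inr ⟨hlen', min (b - p) (1 / β ^ (j + 1)), lt_min (by linarith) (by positivity),
      le_min ?_ ?_, by linarith [min_le_left (b - p) (1 / β ^ (j + 1))],
      hext (β ^ (j + 1) * p) (fun x hx => ⟨hap.le.trans hx.1, ?_⟩) fun x hx => ?_, hright⟩
    · refine le_trans ?_ hbp.le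
      exact div_le_div_of_nonneg_left (by linarith) (by norm_num) (by linarith)
    · refine le_trans ?_ hlen'
      exact div_le_div_of_nonneg_left (by linarith) hb0 (by linarith)
    · linarith [hx.2, min_le_left (b - p) (1 / β ^ (j + 1))]
    · rw [hright x hx]; ring

/-- `exists_branch_onto` in terms of `Lands`. -/
lemma exists_lands {β p L x₁ x₂ : ℝ} (hβ : 1 < β) {n : ℕ} (hL : 0 < L)
    (hx₁ : 0 < x₁) (hx : x₁ < x₂) (hx₂ : x₂ < 1) (h : IsBranch β n (Ico p (p + L)))
    (hf : ∀ x ∈ Ico p (p + L), (betaMap β)^[n] x = β ^ n * (x - p)) :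
    ∃ N ≥ n, ∃ c d, p ≤ c ∧ c < d ∧ d ≤ p + L ∧
      (x₂ - x₁) * min (1 / β ^ n) (L / β) ≤ d - c ∧ Lands β x₁ x₂ N c d := by
  obtain ⟨N, hN, hmin, hlt, hbr, hit⟩ := exists_branch_onto hβ hL hx₁ hx hx₂ h hf
  have hpos : 0 < β ^ N := pow_pos (by linarith) _
  have h1 : 0 < x₁ / β ^ N := div_pos hx₁ hpos
  have h2 : x₁ / β ^ N < x₂ / β ^ N := div_lt_div_of_pos_right hx hpos
  refine ⟨N, hN, p + x₁ / β ^ N, p + x₂ / β ^ N, by linarith, by linarith, by linarith, ?_,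
    hbr, fun x hxI => ?_, ?_⟩
  · rw [add_sub_add_left_eq_sub, ← sub_div, div_eq_mul_one_div (x₂ - x₁)]
    exact mul_le_mul_of_nonneg_left hmin (by linarith)
  · rw [hit x hxI]; field_simp; ring
  · field_simp; ring

/-! ### Strategies for White -/

/-- White can answer the interval whose current image is `[a, b]`, keeping the proportion `α` and
reaching after `j ≥ 1` iterates an image that satisfies `Pos`, all images on the way being
`ρ`-far from `K`. -/
def HasMove (β α ρ : ℝ) (K : Set ℝ) (Pos : ℝ → ℝ → Prop) (a b : ℝ) : Prop :=
  ∃ (c d : ℝ) (j : ℕ) (q : ℝ), a ≤ c ∧ c < d ∧ d ≤ b ∧ d < 1 ∧ 1 ≤ j ∧ α * (b - a) ≤ d - c ∧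
    (∀ x ∈ Icc c d, (betaMap β)^[j] x = β ^ j * x - q) ∧
    (∀ x ∈ Icc c d, ∀ i, 1 ≤ i → i ≤ j → ∀ κ ∈ K, ρ ≤ |(betaMap β)^[i] x - κ|) ∧
    Pos ((betaMap β)^[j] c) ((betaMap β)^[j] d)

lemma Lands.hasMove {β : ℝ} (hβ : 1 < β) {X : Set (ℕ → ℕ)} (hXβ : X ⊆ betaShift β)
    (hX : ∀ s ∈ X, ∀ n, (fun k => s (n + k)) ∈ X) {α ρ D a b c d x₁ x₂ : ℝ} {n : ℕ}
    {Pos : ℝ → ℝ → Prop} (h : Lands β x₁ x₂ n c d) (hn : 1 ≤ n) (ha : 0 ≤ a) (hac : a ≤ c)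
    (hcd : c < d) (hdb : d ≤ b) (hb : b ≤ 1) (hα : 2 * α * (b - a) ≤ d - c)
    (hD : 0 < D) (hDα : D ≤ 2 * α * (b - a)) (hρ : 0 < ρ)
    (hfar : ∀ x ∈ Icc x₁ x₂, ∀ κ ∈ betaProj β '' X, ρ ≤ |x - κ|)
    (hPos : Pos (x₁ + (x₂ - x₁) / 4) (x₂ - (x₂ - x₁) / 4)) :
    HasMove β α (min ρ (D / 4) * D) (betaProj β '' X) Pos a b := by
  have hpos : 0 < β ^ n := pow_pos (by linarith) _
  obtain ⟨q, hq⟩ := h.isBranch n le_rfl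
  have hsub : Icc (c + (d - c) / 4) (d - (d - c) / 4) ⊆ Icc c d :=
    Icc_subset_Icc (by linarith) (by linarith)
  refine ⟨c + (d - c) / 4, d - (d - c) / 4, n, q, by linarith, by linarith, by linarith,
    by linarith, hn, by linarith, fun x hx => hq x (hsub hx), fun x hx i _ hi κ hκ => ?_, ?_⟩
  · refine le_trans ?_ (h.isBranch.le_dist_betaProj hβ hXβ hX (ha.trans hac) hcd (hdb.trans hb)
      hρ hx.1 hx.2 (hfar _ ?_) i hi κ hκ)
    · refine mul_le_mul (min_le_min_left _ (by linarith)) (by linarith) hD.le ?_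
      exact (lt_min hρ (by linarith)).le
    · rw [h.iterate_eq x (hsub hx)]
      have h1 := mul_le_mul_of_nonneg_left (hsub hx).1 hpos.le
      have h2 := mul_le_mul_of_nonneg_left (hsub hx).2 hpos.le
      have h3 := h.length_eq
      constructor <;> linarith
  · rw [h.iterate_eq _ (hsub ⟨le_rfl, by linarith⟩), h.iterate_eq _ (hsub ⟨by linarith, le_rfl⟩)]
    have h3 := h.length_eq
    convert hPos using 1 <;> linarith

/-- A positional winning strategy for White. The predicate `Pos` describes the images `[a, b]` of
White's intervals under the current iterate; it has to hold for the intervals of length at least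
`ℓ`, and White has to be able to restore it after every move of Black. -/
lemma isAlphaWinning_of_hasMove {β α : ℝ} (hβ : 1 < β) (hα : α < 1) {K : Set ℝ}
    (H : ∀ γ ℓ : ℝ, 0 < γ → γ < 1 → 0 < ℓ → ∃ (Pos : ℝ → ℝ → Prop) (ρ : ℝ), 0 < ρ ∧
      (∀ a b, ℓ ≤ b - a → Pos a b) ∧
      ∀ a b a' b', 0 ≤ a → b ≤ 1 → Pos a b → a ≤ a' → a' < b' → b' ≤ b →
        γ * (b - a) ≤ b' - a' → HasMove β α ρ K Pos a' b') :
    IsAlphaWinning α (avoidingSet β K) := by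
  classical
  have hb : 0 < β := by linarith
  intro γ hγ0 hγ1
  choose! Pos ρ hρ hinit hmove using fun ℓ => H γ ℓ hγ0 hγ1
  -- `Good ℓ k I`: at least `k` iterates have been dealt with on `I`. White's intervals have to
  -- avoid the point `1`, which does not belong to `avoidingSet β K`; Black's first interval,
  -- the case `n = 0`, may contain it.
  let Good : ℝ → ℕ → GameInterval → Prop := fun ℓ k I => ∃ n ≥ k,
    (1 ≤ n → I.right < 1) ∧ ∃ q : ℝ,
    (∀ x ∈ I.toSet, (betaMap β)^[n] x = β ^ n * x - q) ∧
    Pos ℓ ((betaMap β)^[n] I.left) ((betaMap β)^[n] I.right) ∧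
    ∀ x ∈ I.toSet, ∀ i, 1 ≤ i → i ≤ n → ∀ κ ∈ K, ρ ℓ ≤ |(betaMap β)^[i] x - κ|
  let Answer : ℝ → ℕ → GameInterval → GameInterval → Prop := fun ℓ k B W =>
    W.toSet ⊆ B.toSet ∧ α * B.length ≤ W.length ∧ Good ℓ k W
  have hstep : ∀ ℓ > 0, ∀ k V B, Good ℓ k V → B.toSet ⊆ V.toSet → γ * V.length ≤ B.length →
      ∃ W, Answer ℓ (k + 1) B W := by
    rintro ℓ hℓ k V B ⟨n, hn, hV1, q, hq, hP, hsafe⟩ hBV hlen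
    have hpos : 0 < β ^ n := pow_pos hb _
    obtain ⟨hl, hr⟩ := (Icc_subset_Icc_iff B.left_lt_right.le).1 hBV
    have hVl := hq V.left (left_mem_Icc.2 V.left_lt_right.le)
    have hVr := hq V.right (right_mem_Icc.2 V.left_lt_right.le)
    have h0 := (iterate_betaMap_mem_Icc (β := β) (x := V.left)
      ⟨V.zero_le_left, V.left_lt_right.le.trans V.right_le_one⟩ n).1
    have h1 := (iterate_betaMap_mem_Icc (β := β) (x := V.right)
      ⟨V.zero_le_left.trans V.left_lt_right.le, V.right_le_one⟩ n).2
    have e1 := mul_le_mul_of_nonneg_left hl hpos.le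
    have e2 := mul_le_mul_of_nonneg_left hr hpos.le
    have e3 := mul_lt_mul_of_pos_left B.left_lt_right hpos
    have e4 := mul_le_mul_of_nonneg_left hlen hpos.le
    simp only [GameInterval.length] at e4
    obtain ⟨c, d, j, q', hc, hcd, hd, hd1, hj, hα', hq', hsafe', hP'⟩ :=
      hmove ℓ hℓ _ _ (β ^ n * B.left - q) (β ^ n * B.right - q) h0 h1 hP (by linarith)
        (by linarith) (by linarith) (by rw [hVl, hVr]; linarith)
    have hcl : B.left ≤ (c + q) / β ^ n := by rw [le_div_iff₀ hpos]; linarith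
    have hdr : (d + q) / β ^ n ≤ B.right := by rw [div_le_iff₀ hpos]; linarith
    have hcd' : (c + q) / β ^ n < (d + q) / β ^ n :=
      div_lt_div_of_pos_right (by linarith) hpos
    let W : GameInterval := ⟨(c + q) / β ^ n, (d + q) / β ^ n,
      B.zero_le_left.trans hcl, hcd', hdr.trans B.right_le_one⟩
    have hWB : W.toSet ⊆ B.toSet := Icc_subset_Icc hcl hdr
    have himg : ∀ x ∈ W.toSet, (betaMap β)^[n] x ∈ Icc c d := by
      intro x hx
      have hx1 := (div_le_iff₀ hpos).1 hx.1
      have hx2 := (le_div_iff₀ hpos).1 hx.2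
      rw [hq x (hBV (hWB hx))]
      constructor <;> linarith
    have hWl : (betaMap β)^[n] W.left = c := by
      rw [hq _ (hBV (hWB (left_mem_Icc.2 hcd'.le)))]
      change β ^ n * ((c + q) / β ^ n) - q = c
      field_simp; ring
    have hWr : (betaMap β)^[n] W.right = d := by
      rw [hq _ (hBV (hWB (right_mem_Icc.2 hcd'.le)))]
      change β ^ n * ((d + q) / β ^ n) - q = d
      field_simp; ring
    have hW1 : W.right < 1 := by
      rcases Nat.eq_zero_or_pos n with rfl | hn0
      · exact hWr.trans_lt hd1
      · exact (hdr.trans hr).trans_lt (hV1 hn0)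
    refine ⟨W, hWB, ?_, j + n, by omega, fun _ => hW1, β ^ j * q + q', fun x hx => ?_, ?_, ?_⟩
    · simp only [GameInterval.length, W]
      rw [← sub_div, le_div_iff₀ hpos]
      linarith
    · rw [Function.iterate_add_apply, hq' _ (himg x hx), hq x (hBV (hWB hx)), pow_add]
      ring
    · rw [Function.iterate_add_apply, Function.iterate_add_apply, hWl, hWr]
      exact hP'
    · intro x hx i hi1 hij κ hκ
      by_cases hin : i ≤ n
      · exact hsafe x (hBV (hWB hx)) i hi1 hin κ hκ
      · obtain ⟨m, rfl⟩ := Nat.exists_eq_add_of_le (Nat.le_of_not_le hin)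
        rw [add_comm, Function.iterate_add_apply]
        exact hsafe' _ (himg x hx) m (by omega) (by omega) κ hκ
  let σ : WhiteStrategy := fun k B =>
    if h : ∃ W, Answer (B 0).length (k + 1) (B (Fin.last k)) W then h.choose else B (Fin.last k)
  refine ⟨σ, fun k B => ?_, fun B hB y hy => ?_⟩
  · by_cases h : ∃ W, Answer (B 0).length (k + 1) (B (Fin.last k)) W
    · simp only [σ, dif_pos h]
      exact ⟨h.choose_spec.1, h.choose_spec.2.1⟩
    · simp only [σ, dif_neg h]
      refine ⟨subset_rfl, mul_le_of_le_one_left ?_ hα.le⟩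
      exact (sub_pos.2 (B (Fin.last k)).left_lt_right).le
  · have hℓ : 0 < (B 0).length := sub_pos.2 (B 0).left_lt_right
    have hσ : ∀ k, (∃ W, Answer (B 0).length (k + 1) (B k) W) →
        Answer (B 0).length (k + 1) (B k) (σ.answer B k) := by
      intro k h
      have h' : ∃ W, Answer (B ((0 : Fin (k + 1)) : ℕ)).length (k + 1)
          (B (Fin.last k : Fin (k + 1))) W := by simpa using h
      simp only [WhiteStrategy.answer, σ, dif_pos h']
      simpa using h'.choose_spec
    have hall : ∀ k, Answer (B 0).length (k + 1) (B k) (σ.answer B k) := by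
      intro k
      induction k with
      | zero =>
        refine hσ 0 (hstep _ hℓ 0 (B 0) (B 0) ⟨0, le_rfl, by simp, 0, by simp, ?_, ?_⟩ subset_rfl
          (mul_le_of_le_one_left hℓ.le hγ1.le))
        · exact hinit _ hℓ _ _ le_rfl
        · intro x _ i h1 h2; omega
      | succ k ih => exact hσ _ (hstep _ hℓ _ _ _ ih.2.2 (hB k).1 (hB k).2)
    rw [mem_iInter] at hy
    obtain ⟨n₀, hn₀, hlt, -⟩ := (hall 0).2.2
    refine ⟨⟨(σ.answer B 0).zero_le_left.trans (hy 0).1, (hy 0).2.trans_lt (hlt hn₀)⟩, ?_⟩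
    rw [eq_empty_iff_forall_notMem]
    rintro κ ⟨hκ, hcl⟩
    obtain ⟨_, ⟨m, hm, rfl⟩, hdist⟩ := Metric.mem_closure_iff.1 hcl _ (hρ _ hℓ)
    obtain ⟨n, hn, -, q, -, -, hsafe⟩ := (hall m).2.2
    have := hsafe y (hy m) m hm (by omega) κ hκ
    rw [dist_comm, Real.dist_eq] at hdist
    linarith

/-! ### The two cases -/

lemma min_div_four_mul_pos {ρ D : ℝ} (hρ : 0 < ρ) (hD : 0 < D) : 0 < min ρ (D / 4) * D :=
  mul_pos (lt_min hρ (by linarith)) hD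

/-- If the left orbit of `1` is bounded away from `0`, every interval contains a subinterval, in a
definite proportion, that is sent onto a given interval `[x₁, x₂]` away from `π_β (X)`. -/
lemma isAlphaWinning_of_le_leftOrbit {β : ℝ} (hβ : 1 < β) {X : Set (ℕ → ℕ)}
    (hXβ : X ⊆ betaShift β) (hX : ∀ s ∈ X, ∀ n, (fun k => s (n + k)) ∈ X) {c : ℝ} (hc0 : 0 < c)
    (hc : ∀ i, c ≤ leftOrbit β i) {x₁ x₂ ρ : ℝ} (hx₁ : 0 < x₁) (hx : x₁ < x₂) (hx₂ : x₂ < 1)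
    (hρ : 0 < ρ) (hfar : ∀ x ∈ Icc x₁ x₂, ∀ κ ∈ betaProj β '' X, ρ ≤ |x - κ|) :
    ∃ α : ℝ, 0 < α ∧ α < 1 ∧ IsAlphaWinning α (avoidingSet β (betaProj β '' X)) := by
  have hb : 0 < β := by linarith
  have hc1 : c ≤ 1 := hc 0
  have hβ2 : 1 ≤ β ^ 2 := one_le_pow₀ hβ.le
  set α := (x₂ - x₁) * c / (4 * β ^ 2) with hαdef
  have hα0 : 0 < α := div_pos (mul_pos (by linarith) hc0) (by linarith)
  have hα1 : α < 1 := by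
    rw [hαdef, div_lt_one (by linarith)]
    nlinarith
  refine ⟨α, hα0, hα1, isAlphaWinning_of_hasMove hβ hα1 fun γ ℓ hγ0 hγ1 hℓ => ?_⟩
  obtain ⟨ε, hε0, hεℓ, hεx⟩ : ∃ ε > 0, ε ≤ ℓ ∧ ε ≤ (x₂ - x₁) / 2 :=
    ⟨_, lt_min hℓ (by linarith), min_le_left _ _, min_le_right _ _⟩
  have hD : 0 < 2 * α * (γ * ε) := by positivity
  refine ⟨fun a b => ε ≤ b - a, _, min_div_four_mul_pos hρ hD, fun a b h => hεℓ.trans h, ?_⟩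
  intro a' b' a b ha' hb' hPos haa hab hbb hγ
  have ha : 0 ≤ a := ha'.trans haa
  have hb1 : b ≤ 1 := hbb.trans hb'
  have hDα : 2 * α * (γ * ε) ≤ 2 * α * (b - a) :=
    mul_le_mul_of_nonneg_left ((mul_le_mul_of_nonneg_left hPos hγ0.le).trans hγ) (by linarith)
  -- A landing interval of the announced proportion is all that is needed.
  suffices ∃ N ≥ 1, ∃ c' d, a ≤ c' ∧ c' < d ∧ d ≤ b ∧
      (x₂ - x₁) * (c / β * ((b - a) / (2 * β))) ≤ d - c' ∧ Lands β x₁ x₂ N c' d by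
    obtain ⟨N, hN, c', d, hac, hcd, hdb, hlen, hland⟩ := this
    refine hland.hasMove hβ hXβ hX hN ha hac hcd hdb hb1 (le_trans (le_of_eq ?_) hlen) hD hDα hρ
      hfar (by linarith)
    rw [hαdef]; field_simp; ring
  have hba : 0 < b - a := by linarith
  obtain ⟨n, p, hn, -, hap, hpb, ⟨hhalf, hu, hbr, hf⟩ | ⟨hn', L, hL, hLba, hLb, hbr, hf⟩⟩ :=
    exists_large_side hβ ha hab hb1
  · obtain ⟨m, hm, p', hap', hpp', hcm, hm', hbr', hf'⟩ :=
      exists_cut_near_one hβ hap hc hu hbr hf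
    obtain ⟨N, hN, c', d, h1, h2, h3, h4, h5⟩ := exists_lands (L := p - p') hβ (by linarith)
      hx₁ hx hx₂ (by rwa [add_sub_cancel]) (by rwa [add_sub_cancel])
    refine ⟨N, by omega, c', d, by linarith, h2, by linarith, le_trans ?_ h4, h5⟩
    have hk : (b - a) / (2 * β) ≤ 1 / β ^ m := by
      refine le_trans ?_ hm'
      rw [← div_div]
      exact div_le_div_of_nonneg_right hhalf hb.le
    refine mul_le_mul_of_nonneg_left (le_min ?_ ?_) (by linarith)
    · refine le_trans (mul_le_of_le_one_left (by positivity) ?_) hk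
      rw [div_le_one hb]; linarith
    · calc c / β * ((b - a) / (2 * β)) ≤ c / β * (1 / β ^ m) :=
            mul_le_mul_of_nonneg_left hk (by positivity)
        _ = c / β ^ m / β := by field_simp
        _ ≤ (p - p') / β := div_le_div_of_nonneg_right hcm hb.le
  · obtain ⟨N, hN, c', d, h1, h2, h3, h4, h5⟩ := exists_lands hβ hL hx₁ hx hx₂ hbr hf
    refine ⟨N, by omega, c', d, by linarith, h2, by linarith, le_trans ?_ h4, h5⟩
    refine mul_le_mul_of_nonneg_left (le_min ?_ ?_) (by linarith)
    · refine le_trans (mul_le_of_le_one_left (by positivity) ?_) (le_trans ?_ hn')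
      · rw [div_le_one hb]; linarith
      · exact div_le_div_of_nonneg_left hba.le hb (by linarith)
    · calc c / β * ((b - a) / (2 * β)) ≤ c / β * L :=
            mul_le_mul_of_nonneg_left hLba (by positivity)
        _ = c * L / β := by ring
        _ ≤ L / β := div_le_div_of_nonneg_right (mul_le_of_le_one_left hL.le hc1) hb.le

/-- A left neighbourhood of `1` without discontinuities of `f_β^M`. -/
lemma isBranch_of_near_one {β η : ℝ} (hβ : 1 < β) {M : ℕ}
    (h : ∀ i ≤ M, β ^ i * η ≤ leftOrbit β i) : IsBranch β M (Ico (1 - η) 1) := by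
  intro i hi
  refine ⟨β ^ i - leftOrbit β i, fun x hx => ?_⟩
  rw [iterate_betaMap_eq_of_near_one hβ hx.2 (fun k hk => ?_) i hi]
  · ring
  · refine (mul_le_mul_of_nonneg_left ?_ (pow_nonneg (by linarith) _)).trans (h k hk)
    linarith [hx.1]

/-- If `π_β (X)` stays away from `1`, White can use left neighbourhoods of `1` as a refuge. After a
cut with a large left part, White moves to the image `[1 - u, 1 - u / 2]`, however small `u` is;
these images do not become arbitrarily small during the game, because very close to `1` there is
no further cut for a long time, and the expansion outweighs what Black gains. -/
lemma isAlphaWinning_of_gap {β : ℝ} (hβ : 1 < β) {X : Set (ℕ → ℕ)}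
    (hXβ : X ⊆ betaShift β) (hX : ∀ s ∈ X, ∀ n, (fun k => s (n + k)) ∈ X) {η : ℝ} (hη : 0 < η)
    (hgap : ∀ κ ∈ betaProj β '' X, κ ≤ 1 - η) :
    ∃ α : ℝ, 0 < α ∧ α < 1 ∧ IsAlphaWinning α (avoidingSet β (betaProj β '' X)) := by
  have hb : 0 < β := by linarith
  have hβ2 : 1 ≤ β ^ 2 := one_le_pow₀ hβ.le
  -- `[1 - v, 1)` is the refuge.
  obtain ⟨v, hv0, hv1, hvη⟩ : ∃ v > 0, v ≤ 1 / 2 ∧ v ≤ η / 2 :=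
    ⟨_, lt_min (by norm_num) (half_pos hη), min_le_left _ _, min_le_right _ _⟩
  have hfar : ∀ x, 1 - v ≤ x → ∀ κ ∈ betaProj β '' X, v ≤ |x - κ| := by
    intro x hx κ hκ
    have := hgap κ hκ
    rw [le_abs]; left; linarith
  set α := v / (8 * β ^ 2) with hαdef
  have hα0 : 0 < α := by positivity
  have hα8 : α ≤ v / 8 := div_le_div_of_nonneg_left hv0.le (by norm_num) (by linarith)
  have hα1 : α < 1 := by linarith
  refine ⟨α, hα0, hα1, isAlphaWinning_of_hasMove hβ hα1 fun γ ℓ hγ0 hγ1 hℓ => ?_⟩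
  obtain ⟨M, hM⟩ := pow_unbounded_of_one_lt (8 / γ) hβ
  rw [div_lt_iff₀ hγ0] at hM
  obtain ⟨η', hη'0, hη'⟩ := exists_near_one hβ M
  obtain ⟨u₀, hu0, huℓ, huv, huη⟩ : ∃ u₀ > 0, u₀ ≤ ℓ ∧ 4 * u₀ ≤ v ∧ 4 * u₀ ≤ η' := by
    refine ⟨min ℓ (min (v / 4) (η' / 4)), by positivity, min_le_left _ _, ?_, ?_⟩
    · linarith [(min_le_right ℓ _).trans (min_le_left (v / 4) (η' / 4))]
    · linarith [(min_le_right ℓ _).trans (min_le_right (v / 4) (η' / 4))]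
  have hbrM : IsBranch β M (Ico (1 - 4 * u₀) 1) := isBranch_of_near_one hβ fun i hi =>
    (mul_le_mul_of_nonneg_left huη (pow_nonneg hb.le _)).trans (hη' i hi)
  set ε := γ * u₀ / 8 with hεdef
  have hε0 : 0 < ε := by positivity
  have hεu : ε ≤ u₀ := by rw [hεdef]; nlinarith
  have hD : 0 < 2 * α * (γ * ε) := by positivity
  -- Images in White's control are long, or lie so close to `1` that `M` iterates do not cut them.
  refine ⟨fun a b => u₀ ≤ b - a ∨ 1 - 4 * u₀ ≤ a ∧ b < 1 ∧ ε ≤ b - a, _,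
    min_div_four_mul_pos hv0 hD, fun a b h => Or.inl (huℓ.trans h), ?_⟩
  intro a' b' a b ha' hb' hPos haa hab hbb hγ
  have ha : 0 ≤ a := ha'.trans haa
  have hb1 : b ≤ 1 := hbb.trans hb'
  have hba : 0 < b - a := by linarith
  have hPosε : ε ≤ b' - a' := hPos.elim hεu.trans fun h => h.2.2
  have hDα : 2 * α * (γ * ε) ≤ 2 * α * (b - a) :=
    mul_le_mul_of_nonneg_left ((mul_le_mul_of_nonneg_left hPosε hγ0.le).trans hγ) (by linarith)
  obtain ⟨n, p, hn, hmax, hap, hpb, ⟨hhalf, hu, hbr, hf⟩ | ⟨hn', L, hL, hLba, hLb, hbr, hf⟩⟩ :=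
    exists_large_side hβ ha hab hb1
  · have hpos : 0 < β ^ n := pow_pos hb _
    set u := β ^ n * (p - a) with hudef
    have hu' : 0 < u := mul_pos hpos (by linarith)
    obtain ⟨t, ht0, htu, htv, ht⟩ : ∃ t > 0, t ≤ u ∧ t ≤ v ∧ (t = u ∨ t = v) :=
      ⟨min u v, lt_min hu' hv0, min_le_left _ _, min_le_right _ _, min_choice _ _⟩
    have htn : t / β ^ n ≤ p - a := by rw [div_le_iff₀ hpos]; linarith
    have htn0 : 0 < t / β ^ n := div_pos ht0 hpos
    have hsub : Icc (p - t / β ^ n) (p - t / β ^ n / 2) ⊆ Ico a p := fun x hx =>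
      ⟨by linarith [hx.1], by linarith [hx.2]⟩
    have hland : Lands β (1 - t) (1 - t / 2) n (p - t / β ^ n) (p - t / β ^ n / 2) := by
      refine ⟨hbr.mono le_rfl hsub, fun x hx => ?_, ?_⟩
      · rw [hf x (hsub hx)]; field_simp; ring
      · field_simp; ring
    refine hland.hasMove hβ hXβ hX hn ha (by linarith) (by linarith) (by linarith) hb1 ?_ hD hDα
      hv0 (fun x hx => hfar x (by linarith [hx.1])) ?_
    · have h1 : v * (b - a) / 2 ≤ t / β ^ n := by
        rw [le_div_iff₀ hpos]
        have h2 : (b - a) / 2 * β ^ n ≤ u := by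
          rw [hudef, mul_comm]; exact mul_le_mul_of_nonneg_left hhalf hpos.le
        rcases ht with rfl | rfl <;> nlinarith
      have := mul_le_mul_of_nonneg_right hα8 hba.le
      linarith
    · by_cases htu₀ : 4 * u₀ ≤ t
      · left; linarith
      · push Not at htu₀
        -- Then `t = u`, since `4 u₀ ≤ v`.
        obtain rfl : t = u := ht.resolve_right (by linarith)
        have h1 : β ^ n * (b - a) ≤ 2 * u := by
          have := mul_le_mul_of_nonneg_left hhalf hpos.le
          linarith
        refine Or.inr ⟨by linarith, by linarith, ?_⟩
        rcases hPos with hbig | ⟨hl, hr, hε⟩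
        · have h2 : b - a ≤ β ^ n * (b - a) := le_mul_of_one_le_left hba.le (one_le_pow₀ hβ.le)
          have h3 := mul_le_mul_of_nonneg_left hbig hγ0.le
          linarith
        · have hMn := hmax M (hbrM.mono le_rfl fun x hx =>
            ⟨by linarith [hx.1], by linarith [hx.2]⟩)
          have h2 : β ^ M * (γ * ε) ≤ β ^ n * (b - a) :=
            mul_le_mul (pow_le_pow_right₀ hβ.le hMn.le)
              ((mul_le_mul_of_nonneg_left hε hγ0.le).trans hγ) (by positivity) hpos.le
          have h3 : 8 * ε ≤ β ^ M * γ * ε := mul_le_mul_of_nonneg_right hM.le hε0.le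
          linarith
  · obtain ⟨N, hN, c, d, h1, h2, h3, h4, h5⟩ := exists_lands (x₁ := 1 - v) (x₂ := 1 - v / 2) hβ hL
      (by linarith) (by linarith) (by linarith) hbr hf
    refine h5.hasMove hβ hXβ hX (by omega) ha (by linarith) h2 (by linarith) hb1
      (le_trans ?_ h4) hD hDα hv0 (fun x hx => hfar x hx.1) (Or.inl (by linarith))
    have hmin : (b - a) / (2 * β) / β ≤ min (1 / β ^ n) (L / β) := by
      refine le_min (le_trans ?_ hn') (div_le_div_of_nonneg_right hLba hb.le)
      rw [div_div]
      exact div_le_div_of_nonneg_left hba.le hb (by nlinarith)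
    refine le_trans (le_of_eq ?_) (mul_le_mul_of_nonneg_left hmin (by linarith))
    rw [hαdef]; field_simp; ring

theorem mainTheorem1 (β : ℝ) (hβ : 1 < β) (X : Set (ℕ → ℕ))
    (hX : IsSubshiftOfFiniteType X) (hXβ : X ⊆ betaShift β)
    (hw : ∃ w : List ℕ, w ∈ language (betaShift β) ∧ w ∉ language X) :
    ∃ α : ℝ, 0 < α ∧ α < 1 ∧ IsAlphaWinning α (avoidingSet β (betaProj β '' X)) := by
  by_cases he : leftDigits β ∈ X
  · obtain ⟨c, hc0, hc⟩ := exists_pos_le_leftOrbit hβ hX hXβ he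
    obtain ⟨w, hwβ, hwX⟩ := hw
    obtain ⟨x₁, x₂, ρ, hx₁, hx, hx₂, hρ, hfar⟩ := exists_hole hβ hX.shift_mem hXβ hwβ hwX
    exact isAlphaWinning_of_le_leftOrbit hβ hXβ hX.shift_mem hc0 hc hx₁ hx hx₂ hρ hfar
  · obtain ⟨η, hη, hgap⟩ := exists_gap_near_one hβ hX hXβ he
    exact isAlphaWinning_of_gap hβ hXβ hX.shift_mem hη hgap
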